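/- Let $\mathbb F_q$ be the finite field with $q$ elements, let $n\ge 1$ and $d\ge 1$ be integers, and write $d-1=a(q-1)+b$ with integers $a\ge 0$ and $0\le b<q-1$. Put $$W_h^{(1)}(q,n,d)=\begin{cases}1 & \text{if } d>n(q-1),\\ (q-b)\,q^{\,n-a-1} & \text{if } d\le n(q-1).\end{cases}$$ For a homogeneous polynomial $f\in\mathbb F_q[X_0,\dots,X_n]$ of degree $d$, let $Z_h(f)$ be its set of zeros in the projective space $\mathbb P^n(q)$ over $\mathbb F_q$ (that is, its set of $\mathbb F_q$-rational zeros). 1. If $f$ is homogeneous of degree $d$ and does not vanish on all of $\mathbb P^n(q)$, then $$\#Z_h(f)\le \frac{q^{n+1}-1}{q-1}-W_h^{(1)}(q,n,d).$$ 2. This bound is attained: for all such $n$ and $d$ there is a homogeneous polynomial $f$ of degree $d$, not vanishing on all of $\mathbb P^n(q)$, for which equality holds. 3. Suppose $d\le n(q-1)$, and let $f$ be homogeneous of degree $d$ and not vanishing on all of $\mathbb P^n(q)$. Equality holds for $f$ if and only if there is a hyperplane $H$ of $\mathbb P^n(q)$ with $H\subseteq Z_h(f)$ such that the restriction of $Z_h(f)$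 to the affine space $\mathbb A^n(q)=\mathbb P^n(q)\setminus H$ is a maximal affine hypersurface of degree $d-1$. Here a *maximal affine hypersurface of degree $d-1=a(q-1)+b$* in $\mathbb A^n(q)$ is a union of affine hyperplanes consisting of $a$ blocks of $q-1$ distinct parallel hyperplanes each and one further block of $b$ distinct parallel hyperplanes, such that the $a+1$ linear forms directing these blocks are linearly independent (that is, a set of the form $\bigcup_{i=1}^{a+1}\bigcup_{c\in T_i}\{x: l_i(x)=c\}$ with linearly independent linear forms $l_1,\dots,l_{a+1}$ on $\mathbb F_q^n$ and subsets $T_i\subseteq\mathbb F_q$ with $\#T_i=q-1$ for $i\le a$ and $\#T_{a+1}=b$, in affine coordinates on $\mathbb A^n(q)$). -/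

import Mathlib

namespace ProjRM

variable {F : Type*} [Field F]

/-- Points of the projective space `ℙⁿ(F)`: lines through the origin in `F^(n+1)`. -/
abbrev PSpace (F : Type*) [Field F] (n : ℕ) : Type _ :=
  Projectivization F (Fin (n + 1) → F)

/-- The set of zeros in `ℙⁿ(F)` of a (homogeneous) polynomial in the variables `X₀, …, Xₙ`.
For a homogeneous polynomial the choice of the representative is irrelevant, see
`mk_mem_projZeros`. -/
def projZeros {n : ℕ} (f : MvPolynomial (Fin (n + 1)) F) : Set (PSpace F n) :=
  {p | MvPolynomial.eval p.rep f = 0}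

theorem mk_mem_projZeros {n d : ℕ} {f : MvPolynomial (Fin (n + 1)) F} (hf : f.IsHomogeneous d)
    (v : Fin (n + 1) → F) (hv : v ≠ 0) :
    Projectivization.mk F v hv ∈ projZeros f ↔ MvPolynomial.eval v f = 0 := by
  obtain ⟨c, hc⟩ := Projectivization.exists_smul_eq_mk_rep F v hv
  have h : MvPolynomial.eval (c • v) f = (c : F) ^ d * MvPolynomial.eval v f := by
    rw [MvPolynomial.eval_eq, MvPolynomial.eval_eq, Finset.mul_sum]
    refine Finset.sum_congr rfl fun m hm => ?_
    have hd : m.sum (fun _ k => k) = d := by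
      have := hf (MvPolynomial.mem_support_iff.mp hm)
      simpa [Finsupp.weight_apply] using this
    have : ∏ i ∈ m.support, ((c : F) * v i) ^ m i
        = (c : F) ^ d * ∏ i ∈ m.support, v i ^ m i := by
      rw [← hd, Finsupp.sum, ← Finset.prod_pow_eq_pow_sum, ← Finset.prod_mul_distrib]
      exact Finset.prod_congr rfl fun i _ => mul_pow _ _ _
    simp only [Pi.smul_apply, Units.smul_def, smul_eq_mul]
    rw [this]
    ring
  simp only [projZeros, Set.mem_ofPred_eq]
  rw [← hc, h]
  simp

/-- A hyperplane of `ℙⁿ(F)`: the set of zeros of a nonzero linear form. -/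
def IsHyperplane {n : ℕ} (H : Set (PSpace F n)) : Prop :=
  ∃ φ : Module.Dual F (Fin (n + 1) → F), φ ≠ 0 ∧ H = {p | φ p.rep = 0}

/-- The affine chart `(x₁, …, xₙ) ↦ (1 : x₁ : … : xₙ)` relative to the projective coordinate
system given by the linear automorphism `e` of `F^(n+1)`. -/
def affineChart {n : ℕ} (e : (Fin (n + 1) → F) ≃ₗ[F] (Fin (n + 1) → F)) (x : Fin n → F) :
    PSpace F n :=
  Projectivization.mk F (e.symm (Fin.cons 1 x)) (by
    intro h
    have h1 : (Fin.cons 1 x : Fin (n + 1) → F) = 0 := by simpa using h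
    have h2 := congrFun h1 0
    simp at h2)

/-- Maximal affine hypersurfaces of degree `k` in `Fⁿ`, where `q = #F` and `k = a (q - 1) + b`
with `0 ≤ b < q - 1`: the unions of `a` blocks of `q - 1` parallel hyperplanes and one block of `b`
parallel hyperplanes, the `a + 1` linear forms directing the blocks being linearly independent.
The `i`-th block consists of the hyperplanes `l i = c` with `c ∈ T i`. -/
def IsMaximalAffine [Fintype F] {n : ℕ} (k : ℕ) (S : Set (Fin n → F)) : Prop :=
  ∃ a b : ℕ, k = a * (Fintype.card F - 1) + b ∧ b < Fintype.card F - 1 ∧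
    ∃ (l : Fin (a + 1) → Module.Dual F (Fin n → F)) (T : Fin (a + 1) → Finset F),
      LinearIndependent F l ∧
      (∀ i : Fin a, (T i.castSucc).card = Fintype.card F - 1) ∧
      (T (Fin.last a)).card = b ∧
      S = ⋃ i, ⋃ c ∈ T i, {x | l i x = c}

/-- The restriction of `V` to the affine space `ℙⁿ(F) \ H` is, in affine coordinates, a maximal
affine hypersurface of degree `k`. -/
def IsMaximalOffHyperplane [Fintype F] {n : ℕ} (k : ℕ) (H V : Set (PSpace F n)) : Prop :=
  ∃ e : (Fin (n + 1) → F) ≃ₗ[F] (Fin (n + 1) → F),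
    Set.range (affineChart e) = Hᶜ ∧ IsMaximalAffine k (affineChart e ⁻¹' V)

/-- The number `W_h^{(1)}(q, n, d)` for `d ≥ 1`: it is `1` if `d > n (q - 1)`, and otherwise
`(q - b) q^(n - a - 1)`, where `a` and `b` are the quotient and the remainder of `d - 1` by
`q - 1`. In the second case `b < q` and `a + 1 ≤ n`, so that no subtraction is truncated. -/
def minWeight (q n d : ℕ) : ℕ :=
  if n * (q - 1) < d then 1
  else (q - (d - 1) % (q - 1)) * q ^ (n - (d - 1) / (q - 1) - 1)

/-- The upper bound `(q^(n+1) - 1) / (q - 1) - W_h^{(1)}(q, n, d)`, a rational number. -/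
def zerosBound (q n d : ℕ) : ℚ :=
  ((q : ℚ) ^ (n + 1) - 1) / ((q : ℚ) - 1) - (minWeight q n d : ℚ)

end ProjRM

/-!
The proof counts the points where `f` does not vanish, and treats polynomials only through the
functions that they define: `DegLE F k f` says that `f` is a polynomial function of degree at most
`k` on a vector space `V`. This notion is stable under restriction to affine subspaces, and a
function of degree at most `k` which vanishes on `t` hyperplanes `l = c` of a pencil is divisible
by the product of their equations (`DegLE.exists_eq_prod_mul`), so that its other slices are zero
sets of functions of degree at most `k - t`.

*Affine space.* Slicing along a pencil and induction on the dimension give the lower bound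
`minWeight q n (k + 1)` for the number of non-zeros of a nonzero function of degree at most `k`
(`le_weight`). If `k = a (q - 1) + b` and equality holds, then in every pencil the number `t` of
hyperplanes consisting of zeros is `0`, `b` or `q - 1`, and the other slices are extremal
themselves (`weight_slice_eq`). If `0 < k`, the case `t = 0` cannot occur for all pencils, since a
set which is neither empty nor everything is not equidistributed over all pencils
(`exists_card_section_ne`). If `t = q - 1` for some pencil, the support lies in a hyperplane and
induction applies. If `t = b` and `a = 0`, the zeros are exactly `b` parallel hyperplanes. If
`t = b` and `0 < a`, some other pencil has `t = q - 1` (`exists_card_zeroSlices_eq`). This determines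
the extremal functions (`hasMaximalZeros_of_weight_eq`).

*Projective space.* A homogeneous `f` of degree `d` is considered as a function on the cone
`F^(n+1)`. If it vanishes on the hyperplane `l = 0`, it is divisible by `l`, and the affine bound
for the degree `d - 1` applies to the complement. If it vanishes on no hyperplane, induction on
`n` and averaging over all hyperplanes give the bound with strict inequality (`weight_cone`).
Hence the equality case reduces to the affine one. Equality is attained by products of linear
forms.
-/

namespace ProjRM

universe u

/-! ### Functions of bounded degree -/

/-- `DegLE F k f` says that the function `f` on the vector space `V` is a polynomial function of
degree at most `k`. The definition is free of coordinates: these functions are generated by the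
constants under addition and multiplication by linear forms. -/
inductive DegLE (F : Type*) [Field F] {V : Type*} [AddCommGroup V] [Module F V] :
    ℕ → (V → F) → Prop
  | const (k : ℕ) (c : F) : DegLE F k fun _ => c
  | add {k : ℕ} {f g : V → F} : DegLE F k f → DegLE F k g → DegLE F k fun x => f x + g x
  | mul {k : ℕ} {f : V → F} (l : Module.Dual F V) :
      DegLE F k f → DegLE F (k + 1) fun x => l x * f x

section Degree

variable {F : Type*} [Field F] {V : Type*} [AddCommGroup V] [Module F V]
  {W : Type*} [AddCommGroup W] [Module F W]

theorem DegLE.smul {k : ℕ} {f : V → F} (h : DegLE F k f) (c : F) :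
    DegLE F k fun x => c * f x := by
  induction h with
  | const k a => exact .const k (c * a)
  | add _ _ h₁ h₂ => simpa only [mul_add] using h₁.add h₂
  | mul l _ h => simpa only [mul_left_comm] using h.mul l

theorem DegLE.succ {k : ℕ} {f : V → F} (h : DegLE F k f) : DegLE F (k + 1) f := by
  induction h with
  | const k a => exact .const _ a
  | add _ _ h₁ h₂ => exact h₁.add h₂
  | mul l _ h => exact h.mul l

theorem DegLE.affine_mul {k : ℕ} {f : V → F} (h : DegLE F k f) (l : Module.Dual F V) (c : F) :
    DegLE F (k + 1) fun x => (l x + c) * f x := by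
  simpa only [add_mul] using (h.mul l).add (h.smul c).succ

theorem DegLE.comp_affine {k : ℕ} {f : V → F} (h : DegLE F k f) (φ : W →ₗ[F] V) (v : V) :
    DegLE F k fun w => f (φ w + v) := by
  induction h with
  | const k a => exact .const _ a
  | add _ _ h₁ h₂ => exact h₁.add h₂
  | mul l _ h => simpa using h.affine_mul (l.comp φ) (l v)

/-- The remainder of the division of `f` by the affine function `l - c` is the composition of `f`
with the projection onto the hyperplane `l = c` along a vector `e` with `l e = 1`. -/
theorem DegLE.exists_sub_eq_mul {k : ℕ} {f : V → F} (h : DegLE F k f) (l : Module.Dual F V)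
    (e : V) (c : F) : ∃ g : V → F, DegLE F (k - 1) g ∧ (k = 0 → ∀ x, g x = 0) ∧
      ∀ x, f x = f (x - (l x - c) • e) + (l x - c) * g x := by
  induction h with
  | const k a => exact ⟨fun _ => 0, .const _ 0, by simp, by simp⟩
  | add _ _ h₁ h₂ =>
    obtain ⟨g₁, hg₁, hz₁, he₁⟩ := h₁
    obtain ⟨g₂, hg₂, hz₂, he₂⟩ := h₂
    refine ⟨_, hg₁.add hg₂, fun hk x => by simp [hz₁ hk, hz₂ hk], fun x => ?_⟩
    linear_combination he₁ x + he₂ x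
  | @mul k f m hf h =>
    obtain ⟨g, hg, hz, he⟩ := h
    refine ⟨fun x => m e * f x + ((m - m e • l) x + c * m e) * g x, (hf.smul _).add ?_,
      by simp, fun x => ?_⟩
    · rcases k with _ | k
      · simpa [hz rfl] using DegLE.const 0 (0 : F)
      · exact hg.affine_mul _ _
    · simp only [map_sub, map_smul, LinearMap.sub_apply, LinearMap.smul_apply, smul_eq_mul]
      linear_combination (m x - (l x - c) * m e) * he x

theorem DegLE.exists_eq_mul {k : ℕ} {f : V → F} (h : DegLE F k f) (hf : ∃ x, f x ≠ 0)
    (l : Module.Dual F V) {e : V} (he : l e = 1) (c : F) (hc : ∀ x, l x = c → f x = 0) :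
    0 < k ∧ ∃ g : V → F, DegLE F (k - 1) g ∧ ∀ x, f x = (l x - c) * g x := by
  obtain ⟨g, hg, hz, hd⟩ := h.exists_sub_eq_mul l e c
  have key : ∀ x, f x = (l x - c) * g x := fun x => by
    rw [hd x, hc (x - (l x - c) • e) (by simp [he]), zero_add]
  refine ⟨Nat.pos_of_ne_zero fun hk => ?_, g, hg, key⟩
  obtain ⟨x, hx⟩ := hf
  exact hx (by rw [key, hz hk, mul_zero])

/-- A nonzero polynomial function vanishing on parallel hyperplanes is divisible by the product of
their equations. -/
theorem DegLE.exists_eq_prod_mul {k : ℕ} {f : V → F} (h : DegLE F k f) (hf : ∃ x, f x ≠ 0)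
    (l : Module.Dual F V) {e : V} (he : l e = 1) (Z : Finset F)
    (hZ : ∀ x, l x ∈ Z → f x = 0) :
    Z.card ≤ k ∧ ∃ g : V → F, DegLE F (k - Z.card) g ∧
      ∀ x, f x = (∏ c ∈ Z, (l x - c)) * g x := by
  classical
  induction Z using Finset.induction_on with
  | empty => exact ⟨by simp, f, by simpa using h, by simp⟩
  | insert c Z hcZ ih =>
    obtain ⟨hk, g, hg, hfg⟩ := ih fun x hx => hZ x (Finset.mem_insert_of_mem hx)
    obtain ⟨x₀, hx₀⟩ := hf
    have hg0 : ∃ x, g x ≠ 0 := ⟨x₀, fun h0 => hx₀ (by rw [hfg, h0, mul_zero])⟩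
    obtain ⟨hpos, g', hg', hgg'⟩ := hg.exists_eq_mul hg0 l he c fun x hx => by
      have h0 := hZ x (by simp [hx])
      rw [hfg, mul_eq_zero, Finset.prod_eq_zero_iff] at h0
      refine h0.resolve_left ?_
      rintro ⟨c', hc', h'⟩
      rw [hx, sub_eq_zero] at h'
      exact hcZ (h' ▸ hc')
    rw [Finset.card_insert_of_notMem hcZ]
    refine ⟨by omega, g', by simpa [Nat.sub_sub] using hg', fun x => ?_⟩
    rw [hfg, hgg', Finset.prod_insert hcZ]
    ring

end Degree

/-! ### Counting -/

section Counting

variable {F : Type*} [Field F]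

/-- The number of points at which `f` does not vanish. -/
noncomputable def weight {V : Type*} (f : V → F) : ℕ := Nat.card {x // f x ≠ 0}

theorem weight_congr {X : Type*} {f g : X → F} (h : ∀ x, f x = 0 ↔ g x = 0) :
    weight f = weight g :=
  Nat.card_congr (Equiv.subtypeEquivRight fun x => not_congr (h x))

theorem weight_pos {V : Type*} [Finite V] {f : V → F} (hf : ∃ x, f x ≠ 0) : 0 < weight f := by
  obtain ⟨x, hx⟩ := hf
  have : Nonempty {x // f x ≠ 0} := ⟨⟨x, hx⟩⟩
  exact Nat.card_pos

theorem weight_eq_zero {V : Type*} [Finite V] {f : V → F} (hf : ∀ x, f x = 0) : weight f = 0 := by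
  simp [weight, hf]

theorem weight_eq_card_iff {V : Type*} [Finite V] {f : V → F} :
    weight f = Nat.card V ↔ ∀ x, f x ≠ 0 := by
  have := Fintype.ofFinite V
  classical
  rw [weight, Nat.card_eq_fintype_card, Nat.card_eq_fintype_card, Fintype.card_subtype]
  simp [Finset.card_eq_iff_eq_univ, Finset.eq_univ_iff_forall]

variable {V : Type*} [AddCommGroup V] [Module F V]

/-- The restriction of `f` to the hyperplane `l = c`, read on `ker l` by the translation by
`c • e`, where `l e = 1`. -/
def slice (f : V → F) (l : Module.Dual F V) (e : V) (c : F) : LinearMap.ker l → F :=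
  fun u => f (u + c • e)

theorem DegLE.slice {k : ℕ} {f : V → F} (h : DegLE F k f) (l : Module.Dual F V) (e : V) (c : F) :
    DegLE F k (slice f l e c) :=
  h.comp_affine (LinearMap.ker l).subtype (c • e)

/-- The projection onto `ker l` along a vector `e` with `l e = 1`. -/
def kerProj (l : Module.Dual F V) {e : V} (he : l e = 1) : V →ₗ[F] LinearMap.ker l :=
  (LinearMap.id - l.smulRight e).codRestrict _ fun x => by simp [he]

@[simp]
theorem coe_kerProj (l : Module.Dual F V) {e : V} (he : l e = 1) (x : V) :
    (kerProj l he x : V) = x - l x • e := rfl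

theorem slice_kerProj (f : V → F) (l : Module.Dual F V) {e : V} (he : l e = 1) {x : V} {c : F}
    (hx : l x = c) : slice f l e c (kerProj l he x) = f x := by
  simp [slice, hx]

theorem exists_apply_eq_one {l : Module.Dual F V} (hl : l ≠ 0) : ∃ e, l e = 1 := by
  obtain ⟨x, hx⟩ : ∃ x, l x ≠ 0 := by
    by_contra! h
    exact hl (LinearMap.ext h)
  exact ⟨(l x)⁻¹ • x, by simp [hx]⟩

theorem finrank_ker [FiniteDimensional F V] {n : ℕ} (hV : Module.finrank F V = n + 1)
    (l : Module.Dual F V) {e : V} (he : l e = 1) : Module.finrank F (LinearMap.ker l) = n := by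
  have h1 := l.finrank_range_add_finrank_ker
  have h2 : LinearMap.range l = ⊤ := LinearMap.range_eq_top.2 fun c => ⟨c • e, by simp [he]⟩
  rw [h2, finrank_top, Module.finrank_self] at h1
  omega

theorem weight_slice (f : V → F) (l : Module.Dual F V) {e : V} (he : l e = 1) (c : F) :
    weight (slice f l e c) = Nat.card {x // f x ≠ 0 ∧ l x = c} :=
  Nat.card_congr
    { toFun := fun u => ⟨u.1 + c • e, u.2, by simp [he]⟩
      invFun := fun x => ⟨kerProj l he x.1, by rw [slice_kerProj f l he x.2.2]; exact x.2.1⟩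
      left_inv := fun u => by ext; simp [he]
      right_inv := fun x => by ext; simp [x.2.2] }

theorem weight_eq_sum [Fintype F] [Finite V] (f : V → F) (l : Module.Dual F V) {e : V}
    (he : l e = 1) : weight f = ∑ c, weight (slice f l e c) := by
  simp only [weight_slice f l he]
  rw [← Nat.card_sigma]
  exact Nat.card_congr
    { toFun := fun x => ⟨l x.1, x.1, x.2, rfl⟩
      invFun := fun x => ⟨x.2.1, x.2.2.1⟩
      left_inv := fun _ => rfl
      right_inv := by rintro ⟨_, x, hx, rfl⟩; rfl }

theorem card_eq_pow [Fintype F] [Finite V] {n : ℕ} (hV : Module.finrank F V = n) :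
    Nat.card V = Fintype.card F ^ n := by
  rw [Module.natCard_eq_pow_finrank (K := F), hV, Nat.card_eq_fintype_card]

/-- The number of linear forms vanishing at a nonzero point. -/
theorem card_dual_apply_eq_zero [Fintype F] [Finite V] {n : ℕ} (hV : Module.finrank F V = n + 1)
    {y : V} (hy : y ≠ 0) : Nat.card {l : Module.Dual F V // l y = 0} = Fintype.card F ^ n := by
  obtain ⟨e, he⟩ := Module.Projective.exists_dual_ne_zero F hy
  obtain ⟨ev, hev⟩ : ∃ ev : Module.Dual F (Module.Dual F V), ∀ l, ev l = l y :=
    ⟨Module.Dual.eval F V y, fun _ => rfl⟩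
  have h1 : ev ((e y)⁻¹ • e) = 1 := by rw [hev]; simp [he]
  have hD : Module.finrank F (Module.Dual F V) = n + 1 := by rw [Subspace.dual_finrank_eq, hV]
  have hfin : Finite (Module.Dual F V) := Module.finite_of_finite F
  rw [← card_eq_pow (V := LinearMap.ker ev) (finrank_ker hD ev h1)]
  exact Nat.card_congr (Equiv.subtypeEquivRight fun l => by rw [LinearMap.mem_ker, hev])

end Counting

/-! ### The numbers `minWeight` -/

section Arithmetic

theorem minWeight_of_lt {Q n a b : ℕ} (ha : a < n) (hb : b < Q) :
    minWeight (Q + 1) n (a * Q + b + 1) = (Q + 1 - b) * (Q + 1) ^ (n - a - 1) := by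
  have h1 : ¬ n * Q < a * Q + b + 1 := by nlinarith
  have h2 : (a * Q + b) / Q = a := by
    rw [mul_comm, Nat.mul_add_div (by omega), Nat.div_eq_of_lt hb, add_zero]
  have h3 : (a * Q + b) % Q = b := by
    rw [mul_comm, Nat.mul_add_mod, Nat.mod_eq_of_lt hb]
  simp [minWeight, h1, h2, h3]

theorem minWeight_of_le {Q n k : ℕ} (h : n * Q ≤ k) : minWeight (Q + 1) n (k + 1) = 1 := by
  simp [minWeight, Nat.lt_succ_of_le h]

theorem minWeight_pos {Q : ℕ} (hQ : 0 < Q) (n k : ℕ) : 0 < minWeight (Q + 1) n (k + 1) := by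
  have h := Nat.mod_lt k hQ
  simp only [minWeight, add_tsub_cancel_right]
  split_ifs
  · exact one_pos
  · exact Nat.mul_pos (by omega) (by positivity)

theorem minWeight_mul_add_le {Q n a b : ℕ} (ha : a ≤ n) (hb : b < Q) :
    minWeight (Q + 1) n (a * Q + b + 1) ≤ minWeight (Q + 1) n (a * Q + 1) := by
  rcases ha.lt_or_eq with ha | rfl
  · rw [minWeight_of_lt ha hb]
    have := minWeight_of_lt ha (b := 0) (Q := Q) (by omega)
    rw [add_zero] at this
    rw [this]
    exact Nat.mul_le_mul_right _ (by omega)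
  · rw [minWeight_of_le (by omega), minWeight_of_le le_rfl]

/-- The recursive inequality behind the affine bound: `t` is the number of hyperplanes of a pencil
on which a function vanishes, and for extremal functions only three values of `t` are possible. -/
theorem minWeight_succ_le {Q n a b t : ℕ} (hb : b < Q) (ha : a ≤ n) (ht : t ≤ Q)
    (htk : t ≤ a * Q + b) :
    minWeight (Q + 1) (n + 1) (a * Q + b + 1) ≤
        (Q + 1 - t) * minWeight (Q + 1) n (a * Q + b - t + 1) ∧
      (minWeight (Q + 1) (n + 1) (a * Q + b + 1) =
        (Q + 1 - t) * minWeight (Q + 1) n (a * Q + b - t + 1) → t = 0 ∨ t = b ∨ t = Q) := by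
  rw [minWeight_of_lt (Nat.lt_succ_of_le ha) hb]
  rcases le_or_gt t b with htb | htb
  · obtain ⟨s, rfl⟩ := Nat.exists_eq_add_of_le htb
    rw [show a * Q + (t + s) - t = a * Q + s by omega]
    rcases ha.lt_or_eq with ha | rfl
    · rw [minWeight_of_lt ha (by omega), show n + 1 - a - 1 = (n - a - 1) + 1 by omega,
        pow_succ', ← mul_assoc, ← mul_assoc]
      have hpos : 0 < (Q + 1) ^ (n - a - 1) := by positivity
      obtain ⟨r, hr⟩ := Nat.exists_eq_add_of_lt hb
      have key : (Q + 1 - t) * (Q + 1 - s) = (Q + 1 - (t + s)) * (Q + 1) + t * s := by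
        rw [show Q + 1 - t = s + r + 2 by omega, show Q + 1 - s = t + r + 2 by omega,
          show Q + 1 - (t + s) = r + 2 by omega, hr]
        ring
      rw [key]
      refine ⟨Nat.mul_le_mul_right _ (by omega), fun h => ?_⟩
      have h1 := Nat.eq_of_mul_eq_mul_right hpos h
      have h2 : t * s = 0 := by omega
      rcases Nat.mul_eq_zero.1 h2 with h | h <;> omega
    · rw [minWeight_of_le (by omega)]
      rw [show a.succ - a - 1 = 0 by omega, pow_zero, mul_one, mul_one]
      omega
  · obtain ⟨a, rfl⟩ : ∃ a', a = a' + 1 :=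
      Nat.exists_eq_succ_of_ne_zero (by rintro rfl; omega)
    rw [show (a + 1) * Q + b - t = a * Q + (Q + b - t) by rw [add_mul]; omega,
      minWeight_of_lt (by omega) (by omega), show n + 1 - (a + 1) - 1 = n - a - 1 by omega,
      ← mul_assoc]
    have hpos : 0 < (Q + 1) ^ (n - a - 1) := by positivity
    obtain ⟨s, rfl⟩ := Nat.exists_eq_add_of_lt htb
    obtain ⟨r, rfl⟩ := Nat.exists_eq_add_of_le ht
    have key : (b + s + 1 + r + 1 - (b + s + 1)) *
          (b + s + 1 + r + 1 - (b + s + 1 + r + b - (b + s + 1))) =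
        (b + s + 1 + r + 1 - b) + r * (s + 1) := by
      rw [show b + s + 1 + r + 1 - (b + s + 1) = r + 1 by omega,
        show b + s + 1 + r + 1 - (b + s + 1 + r + b - (b + s + 1)) = s + 2 by omega,
        show b + s + 1 + r + 1 - b = s + r + 2 by omega]
      ring
    rw [key]
    refine ⟨Nat.mul_le_mul_right _ (by omega), fun h => ?_⟩
    have h1 := Nat.eq_of_mul_eq_mul_right hpos h
    have h2 : r * (s + 1) = 0 := by omega
    rcases Nat.mul_eq_zero.1 h2 with h | h <;> omega

theorem minWeight_succ_le' {Q : ℕ} (hQ : 0 < Q) {n k t : ℕ} (ht : t ≤ Q) (htk : t ≤ k) :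
    minWeight (Q + 1) (n + 1) (k + 1) ≤ (Q + 1 - t) * minWeight (Q + 1) n (k - t + 1) := by
  rcases le_or_gt ((n + 1) * Q) k with h | h
  · rw [minWeight_of_le h]
    exact Nat.mul_pos (by omega) (minWeight_pos hQ _ _)
  · have hk := Nat.div_add_mod' k Q
    have := (minWeight_succ_le (n := n) (Nat.mod_lt k hQ)
      (Nat.lt_succ_iff.1 ((Nat.div_lt_iff_lt_mul hQ).2 h)) ht (hk.symm ▸ htk)).1
    rwa [hk] at this

end Arithmetic

/-! ### The affine bound -/

section AffineBound

variable {F : Type*} [Field F] [Fintype F]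

theorem one_lt_q : 1 < Fintype.card F := Fintype.one_lt_card

open Classical in
/-- The set of `c` such that `f` vanishes on the hyperplane `l = c`. -/
noncomputable def zeroSlices {V : Type*} [AddCommGroup V] [Module F V] (f : V → F)
    (l : Module.Dual F V) : Finset F :=
  Finset.univ.filter fun c => ∀ x, l x = c → f x = 0

section Pencil

variable {V : Type*} [AddCommGroup V] [Module F V]

theorem mem_zeroSlices {f : V → F} {l : Module.Dual F V} {c : F} :
    c ∈ zeroSlices f l ↔ ∀ x, l x = c → f x = 0 := by
  simp [zeroSlices]

theorem slice_eq_zero_of_mem {f : V → F} {l : Module.Dual F V} {e : V} (he : l e = 1) {c : F}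
    (hc : c ∈ zeroSlices f l) (u : LinearMap.ker l) : slice f l e c u = 0 :=
  mem_zeroSlices.1 hc _ (by simp [he])

theorem exists_slice_ne_zero {f : V → F} {l : Module.Dual F V} {e : V} (he : l e = 1) {c : F}
    (hc : c ∉ zeroSlices f l) : ∃ u, slice f l e c u ≠ 0 := by
  simp only [mem_zeroSlices, not_forall] at hc
  obtain ⟨x, hx, hfx⟩ := hc
  exact ⟨kerProj l he x, by rwa [slice_kerProj f l he hx]⟩

theorem card_zeroSlices_lt {f : V → F} (hf : ∃ x, f x ≠ 0) (l : Module.Dual F V) :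
    (zeroSlices f l).card < Fintype.card F := by
  obtain ⟨x, hx⟩ := hf
  exact Finset.card_lt_univ_of_notMem (x := l x) fun h => hx (mem_zeroSlices.1 h x rfl)

theorem weight_eq_sum_compl [Finite V] (f : V → F) (l : Module.Dual F V) {e : V} (he : l e = 1)
    [DecidableEq F] : weight f = ∑ c ∈ (zeroSlices f l)ᶜ, weight (slice f l e c) := by
  rw [weight_eq_sum f l he]
  refine (Finset.sum_subset (Finset.subset_univ _) fun c _ hc => weight_eq_zero fun u => ?_).symm
  exact slice_eq_zero_of_mem he (by simpa using hc) u

/-- After division by the equations of the `t` hyperplanes of the pencil on which `f` vanishes, the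
other slices acquire degree at most `k - t`. -/
theorem exists_degLE_slice {k : ℕ} {f : V → F} (h : DegLE F k f) (hf : ∃ x, f x ≠ 0)
    (l : Module.Dual F V) {e : V} (he : l e = 1) :
    (zeroSlices f l).card ≤ k ∧ ∀ c ∉ zeroSlices f l, ∃ g : LinearMap.ker l → F,
      DegLE F (k - (zeroSlices f l).card) g ∧ ∀ u, g u = 0 ↔ slice f l e c u = 0 := by
  obtain ⟨hk, g, hg, hfg⟩ := h.exists_eq_prod_mul hf l he (zeroSlices f l)
    fun x hx => mem_zeroSlices.1 hx x rfl
  refine ⟨hk, fun c hc => ⟨slice g l e c, hg.slice l e c, fun u => ?_⟩⟩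
  simp only [slice, hfg, mul_eq_zero, Finset.prod_eq_zero_iff]
  refine ⟨Or.inr, fun h => h.resolve_left ?_⟩
  rintro ⟨c', hc', h'⟩
  simp only [map_add, LinearMap.map_coe_ker, map_smul, he, smul_eq_mul, mul_one, zero_add,
    sub_eq_zero] at h'
  exact hc (h' ▸ hc')

end Pencil

/-- The lower bound for the weight of a nonzero function of degree at most `k`. -/
theorem le_weight {n k : ℕ} {V : Type u} [AddCommGroup V] [Module F V] [Finite V]
    (hV : Module.finrank F V = n) {f : V → F} (h : DegLE F k f) (hf : ∃ x, f x ≠ 0) :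
    minWeight (Fintype.card F) n (k + 1) ≤ weight f := by
  classical
  obtain ⟨Q, hq⟩ : ∃ Q, Fintype.card F = Q + 1 :=
    Nat.exists_eq_succ_of_ne_zero (by have := one_lt_q (F := F); omega)
  have hQ : 0 < Q := by have := one_lt_q (F := F); omega
  induction n generalizing V k with
  | zero =>
    rw [hq, minWeight_of_le (by simp)]
    exact weight_pos hf
  | succ n ih =>
    have : Nontrivial V := Module.nontrivial_of_finrank_pos (R := F) (by omega)
    obtain ⟨y, hy⟩ := exists_ne (0 : V)
    obtain ⟨l, hl⟩ := Module.Projective.exists_dual_ne_zero F hy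
    obtain ⟨e, he⟩ := exists_apply_eq_one (l := l) (by rintro rfl; simp at hl)
    obtain ⟨htk, hs⟩ := exists_degLE_slice h hf l he
    have ht := card_zeroSlices_lt hf l
    rw [weight_eq_sum_compl f l he]
    calc minWeight (Fintype.card F) (n + 1) (k + 1)
        ≤ (zeroSlices f l)ᶜ.card *
            minWeight (Fintype.card F) n (k - (zeroSlices f l).card + 1) := by
          rw [Finset.card_compl, hq]
          rw [hq] at ht
          exact minWeight_succ_le' hQ (by omega) htk
      _ ≤ _ := by
          rw [← smul_eq_mul]
          refine Finset.card_nsmul_le_sum _ _ _ fun c hc => ?_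
          rw [Finset.mem_compl] at hc
          obtain ⟨g, hg, hgs⟩ := hs c hc
          rw [← weight_congr hgs]
          obtain ⟨u, hu⟩ := exists_slice_ne_zero he hc
          exact ih (finrank_ker hV l he) hg ⟨u, fun h0 => hu ((hgs u).1 h0)⟩

end AffineBound

/-! ### Hyperplane sections -/

section Radon

variable {F : Type*} [Field F] [Fintype F] {V : Type*} [AddCommGroup V] [Module F V] [Finite V]

open Classical in
/-- Counting the pairs `(l, x)` of a linear form and a point `x` of the support of `f` on the
hyperplane `l = l p` through `p` in two ways. -/
theorem sum_card_section [Fintype (Module.Dual F V)] {n : ℕ} (hV : Module.finrank F V = n + 1)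
    (f : V → F) (p : V) :
    ∑ l : Module.Dual F V, Nat.card {x // f x ≠ 0 ∧ l x = l p} =
      weight f * Fintype.card F ^ n +
        if f p = 0 then 0 else Fintype.card F ^ (n + 1) - Fintype.card F ^ n := by
  have : Fintype {x // f x ≠ 0} := Fintype.ofFinite _
  have hD : Nat.card (Module.Dual F V) = Fintype.card F ^ (n + 1) :=
    card_eq_pow (by rw [Subspace.dual_finrank_eq, hV])
  have hle : Fintype.card F ^ n ≤ Fintype.card F ^ (n + 1) :=
    Nat.pow_le_pow_right Fintype.card_pos n.le_succ
  have hone (x : {x // f x ≠ 0}) : Nat.card {l : Module.Dual F V // l (x - p) = 0} =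
      Fintype.card F ^ n +
        if p = x then Fintype.card F ^ (n + 1) - Fintype.card F ^ n else 0 := by
    split_ifs with h
    · rw [Nat.add_sub_cancel' hle, ← hD, ← h]
      simp only [sub_self, map_zero]
      exact Nat.card_congr (Equiv.subtypeUnivEquiv fun _ => trivial)
    · exact card_dual_apply_eq_zero hV (sub_ne_zero.2 (Ne.symm h))
  rw [← Nat.card_sigma]
  calc _ = Nat.card (Σ x : {x // f x ≠ 0}, {l : Module.Dual F V // l (x - p) = 0}) :=
        Nat.card_congr
          { toFun := fun y => ⟨⟨y.2.1, y.2.2.1⟩, y.1, by simp [y.2.2.2]⟩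
            invFun := fun y => ⟨y.2.1, y.1.1, y.1.2, by simpa [sub_eq_zero] using y.2.2⟩
            left_inv := fun _ => rfl
            right_inv := fun _ => rfl }
    _ = _ := by
        rw [Nat.card_sigma]
        simp only [hone, Finset.sum_add_distrib, Finset.sum_const, smul_eq_mul]
        congr 1
        · rw [Finset.card_univ, weight, Nat.card_eq_fintype_card]
        · split_ifs with h
          · exact Finset.sum_eq_zero fun x _ => if_neg fun (hx : p = x) => x.2 (hx ▸ h)
          · rw [Finset.sum_eq_single ⟨p, h⟩
              (fun x _ hx => if_neg fun hp => hx (Subtype.ext hp.symm)) (by simp), if_pos rfl]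

/-- A set that is neither empty nor the whole space is not equidistributed over the hyperplanes of
every pencil of parallel hyperplanes: otherwise the total number of incidences of its points with
hyperplanes through `p` would not depend on whether `p` lies in the set. -/
theorem exists_card_section_ne {n : ℕ} (hV : Module.finrank F V = n + 1) {f : V → F}
    (h1 : ∃ x, f x ≠ 0) (h0 : ∃ x, f x = 0) : ∃ l : Module.Dual F V, l ≠ 0 ∧ ∃ c c' : F,
      Nat.card {x // f x ≠ 0 ∧ l x = c} ≠ Nat.card {x // f x ≠ 0 ∧ l x = c'} := by
  by_contra! h
  obtain ⟨p, hp⟩ := h1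
  obtain ⟨p', hp'⟩ := h0
  have hfin : Finite (Module.Dual F V) := Module.finite_of_finite F
  have := Fintype.ofFinite (Module.Dual F V)
  have key : ∑ l : Module.Dual F V, Nat.card {x // f x ≠ 0 ∧ l x = l p} =
      ∑ l : Module.Dual F V, Nat.card {x // f x ≠ 0 ∧ l x = l p'} := by
    refine Finset.sum_congr rfl fun l _ => ?_
    rcases eq_or_ne l 0 with rfl | hl
    · simp
    · exact h l hl _ _
  rw [sum_card_section hV, sum_card_section hV, if_neg hp, if_pos hp'] at key
  have := Nat.pow_lt_pow_right (one_lt_q (F := F)) (Nat.lt_add_one n)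
  omega

end Radon

/-! ### The extremal functions in affine space -/

theorem exists_hyperplane_of_weight_eq_one {F : Type*} [Field F] {n : ℕ} {V : Type*}
    [AddCommGroup V] [Module F V] (hV : Module.finrank F V = n) (hn : 0 < n) {f : V → F}
    (hf : weight f = 1) :
    ∃ l : Module.Dual F V, l ≠ 0 ∧ ∃ s, ∀ x, f x ≠ 0 → l x = s := by
  have : Nontrivial V := Module.nontrivial_of_finrank_pos (R := F) (by omega)
  obtain ⟨y, hy⟩ := exists_ne (0 : V)
  obtain ⟨l, hl⟩ := Module.Projective.exists_dual_ne_zero F hy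
  obtain ⟨h1, ⟨p, hp⟩⟩ := Nat.card_eq_one_iff_unique.1 hf
  exact ⟨l, by rintro rfl; simp at hl, l p, fun x hx => by
    rw [Subtype.mk.inj (h1.elim ⟨x, hx⟩ ⟨p, hp⟩)]⟩

section Extremal

variable {F : Type*} [Field F] [Fintype F]

/-- The zero set of `f` consists of `a` blocks of `q - 1` parallel hyperplanes and one block of `b`
parallel hyperplanes, directed by linearly independent linear forms. -/
def HasMaximalZeros {V : Type*} [AddCommGroup V] [Module F V] (a b : ℕ) (f : V → F) : Prop :=
  ∃ (l : Fin (a + 1) → Module.Dual F V) (T : Fin (a + 1) → Finset F),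
    LinearIndependent F l ∧ (∀ i : Fin a, (T i.castSucc).card = Fintype.card F - 1) ∧
      (T (Fin.last a)).card = b ∧ ∀ x, f x = 0 ↔ ∃ i, l i x ∈ T i

section Structure

variable {V : Type*} [AddCommGroup V] [Module F V]

theorem exists_forall_notMem_eq {T : Finset F} (hT : T.card = Fintype.card F - 1) :
    ∃ s, ∀ c, c ∉ T ↔ c = s := by
  classical
  have h1 : Tᶜ.card = 1 := by
    have := one_lt_q (F := F)
    rw [Finset.card_compl]
    omega
  obtain ⟨s, hs⟩ := Finset.card_eq_one.1 h1
  exact ⟨s, fun c => by rw [← Finset.mem_compl, hs, Finset.mem_singleton]⟩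

theorem hasMaximalZeros_zero {l : Module.Dual F V} (hl : l ≠ 0) {f : V → F} (T : Finset F)
    (hf : ∀ x, f x = 0 ↔ l x ∈ T) : HasMaximalZeros 0 T.card f :=
  ⟨fun _ => l, fun _ => T, (linearIndependent_unique_iff (ι := Fin 1)).2 hl, fun i => i.elim0, rfl,
    fun x => by rw [hf, exists_const]⟩

theorem HasMaximalZeros.exists_hyperplane {a b : ℕ} (ha : 0 < a) {f : V → F}
    (h : HasMaximalZeros a b f) : ∃ l : Module.Dual F V, l ≠ 0 ∧ ∃ s, ∀ x, f x ≠ 0 → l x = s := by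
  obtain ⟨l, T, hl, hT, -, hf⟩ := h
  obtain ⟨s, hs⟩ := exists_forall_notMem_eq (hT ⟨0, ha⟩)
  refine ⟨l (Fin.castSucc ⟨0, ha⟩), hl.ne_zero _, s, fun x hx => (hs _).1 fun hx' => hx ?_⟩
  exact (hf x).2 ⟨_, hx'⟩

/-- A function supported on a hyperplane inherits the structure of its restriction. -/
theorem HasMaximalZeros.of_slice {a b : ℕ} {f : V → F} {l : Module.Dual F V} {e : V}
    (he : l e = 1) {c : F} (hc : ∀ x, l x ≠ c → f x = 0)
    (h : HasMaximalZeros a b (slice f l e c)) : HasMaximalZeros (a + 1) b f := by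
  classical
  obtain ⟨m, T, hm, hT, hTb, hf⟩ := h
  have hcomp : ∀ φ : Module.Dual F (LinearMap.ker l), (kerProj l he).dualMap φ e = 0 := by
    intro φ
    have : kerProj l he e = 0 := by ext; simp [he]
    rw [LinearMap.dualMap_apply, this, map_zero]
  have hsurj : Function.Surjective (kerProj l he) := fun u => ⟨u, by ext; simp⟩
  refine ⟨Fin.cons l fun i => (kerProj l he).dualMap (m i), Fin.cons (Finset.univ.erase c) T,
    ?_, ?_, ?_, fun x => ?_⟩
  · rw [linearIndependent_finCons]
    constructor
    · exact hm.map' _ (LinearMap.ker_eq_bot.2 (LinearMap.dualMap_injective_of_surjective hsurj))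
    · intro hl
      have hle : Submodule.span F (Set.range fun i => (kerProj l he).dualMap (m i)) ≤
          LinearMap.ker (Module.Dual.eval F V e) := by
        rw [Submodule.span_le]
        rintro _ ⟨i, rfl⟩
        exact hcomp (m i)
      have : l e = 0 := hle hl
      rw [he] at this
      exact one_ne_zero this
  · intro i
    refine Fin.cases ?_ (fun j => ?_) i
    · simp [Finset.card_erase_of_mem]
    · simpa [← Fin.succ_castSucc] using hT j
  · rw [← Fin.succ_last, Fin.cons_succ, hTb]
  · rw [Fin.exists_fin_succ]
    simp only [Fin.cons_zero, Fin.cons_succ, Finset.mem_erase, Finset.mem_univ, and_true,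
      LinearMap.dualMap_apply, ← hf]
    by_cases hx : l x = c
    · simp [slice_kerProj f l he hx, hx]
    · simp [hx, hc x hx]

end Structure

theorem minWeight_one (Q n : ℕ) (hQ : 0 < Q) : minWeight (Q + 1) n 1 = (Q + 1) ^ n := by
  rcases n with _ | n
  · simpa using minWeight_of_le (Q := Q) (n := 0) (k := 0) (by simp)
  · simpa [pow_succ'] using minWeight_of_lt (Q := Q) (n := n + 1) (a := 0) (b := 0) (by simp) hQ

theorem minWeight_lt_pow {Q n a b : ℕ} (ha : a < n) (hb : b < Q) (hab : a * Q + b ≠ 0) :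
    minWeight (Q + 1) n (a * Q + b + 1) < (Q + 1) ^ n := by
  rw [minWeight_of_lt ha hb]
  rcases Nat.eq_zero_or_pos a with rfl | ha0
  · calc (Q + 1 - b) * (Q + 1) ^ (n - 0 - 1) < (Q + 1) * (Q + 1) ^ (n - 0 - 1) :=
          Nat.mul_lt_mul_of_pos_right (by omega) (by positivity)
      _ = (Q + 1) ^ n := by rw [← pow_succ']; congr 1; omega
  · calc (Q + 1 - b) * (Q + 1) ^ (n - a - 1) ≤ (Q + 1) * (Q + 1) ^ (n - a - 1) :=
          Nat.mul_le_mul_right _ (by omega)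
      _ = (Q + 1) ^ (n - a) := by rw [← pow_succ']; congr 1; omega
      _ < (Q + 1) ^ n := Nat.pow_lt_pow_right (by omega) (by omega)

/-- For an extremal function the bound obtained from any pencil is sharp, so all its nonzero slices
are extremal for the degree lowered by the number of zero slices. -/
theorem weight_slice_eq {Q n a b : ℕ} (hq : Fintype.card F = Q + 1) (hb : b < Q)
    {V : Type u} [AddCommGroup V] [Module F V] [Finite V] (hV : Module.finrank F V = n + 1)
    (ha : a ≤ n) {f : V → F} (h : DegLE F (a * Q + b) f)
    (hw : weight f = minWeight (Q + 1) (n + 1) (a * Q + b + 1))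
    (l : Module.Dual F V) {e : V} (he : l e = 1) :
    ((zeroSlices f l).card = 0 ∨ (zeroSlices f l).card = b ∨ (zeroSlices f l).card = Q) ∧
      ∀ c ∉ zeroSlices f l, weight (slice f l e c) =
        minWeight (Q + 1) n (a * Q + b - (zeroSlices f l).card + 1) := by
  classical
  have hf : ∃ x, f x ≠ 0 := by
    by_contra! h0
    have := minWeight_pos (by omega : 0 < Q) (n + 1) (a * Q + b)
    rw [weight_eq_zero h0] at hw
    omega
  obtain ⟨htk, hs⟩ := exists_degLE_slice h hf l he
  have ht := card_zeroSlices_lt hf l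
  rw [hq] at ht
  have hle : ∀ c ∈ (zeroSlices f l)ᶜ, minWeight (Q + 1) n (a * Q + b - (zeroSlices f l).card + 1) ≤
      weight (slice f l e c) := by
    intro c hc
    rw [Finset.mem_compl] at hc
    obtain ⟨g, hg, hgs⟩ := hs c hc
    obtain ⟨u, hu⟩ := exists_slice_ne_zero he hc
    rw [← weight_congr hgs, ← hq]
    exact le_weight (finrank_ker hV l he) hg ⟨u, fun h0 => hu ((hgs u).1 h0)⟩
  have hsum := Finset.sum_le_sum hle
  obtain ⟨h1, h2⟩ := minWeight_succ_le hb ha (Nat.lt_succ_iff.1 ht) htk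
  have hconst : ∑ c ∈ (zeroSlices f l)ᶜ,
      minWeight (Q + 1) n (a * Q + b - (zeroSlices f l).card + 1) =
        (Q + 1 - (zeroSlices f l).card) *
          minWeight (Q + 1) n (a * Q + b - (zeroSlices f l).card + 1) := by
    rw [Finset.sum_const, Finset.card_compl, hq, smul_eq_mul]
  rw [← weight_eq_sum_compl f l he, hw, hconst] at hsum
  have heq := le_antisymm h1 hsum
  refine ⟨h2 heq, fun c hc => ?_⟩
  rw [← hconst, ← hw, weight_eq_sum_compl f l he] at heq
  exact ((Finset.sum_eq_sum_iff_of_le hle).1 heq.symm c (Finset.mem_compl.2 hc)).symm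

/-- If the extremal functions are known in dimension `n`, an extremal function in dimension `n + 1`
with `0 < a` and with a pencil of exactly `b` zero slices is supported on a hyperplane. Indeed, the
support of a nonzero slice of this pencil lies in an affine subspace of codimension two, hence in a
hyperplane which contains a further point of the support of `f`. The section with that hyperplane
has too many points for a pencil with `0` or `b` zero slices. -/
theorem exists_card_zeroSlices_eq {Q n a b : ℕ} (hq : Fintype.card F = Q + 1) (hb : b < Q)
    {V : Type u} [AddCommGroup V] [Module F V] [Finite V] (hV : Module.finrank F V = n + 1)
    (ha : a ≤ n) (ha0 : 0 < a) {f : V → F} (h : DegLE F (a * Q + b) f)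
    (hw : weight f = minWeight (Q + 1) (n + 1) (a * Q + b + 1))
    (ih : ∀ {W : Type u} [AddCommGroup W] [Module F W] [Finite W], Module.finrank F W = n →
      ∀ {g : W → F}, a < n → DegLE F (a * Q) g → weight g = minWeight (Q + 1) n (a * Q + 1) →
        HasMaximalZeros a 0 g)
    {l : Module.Dual F V} {e : V} (he : l e = 1) (hl : (zeroSlices f l).card = b) :
    ∃ m : Module.Dual F V, m ≠ 0 ∧ (zeroSlices f m).card = Q := by
  classical
  have hf : ∃ x, f x ≠ 0 := by
    by_contra! h0
    have := minWeight_pos (by omega : 0 < Q) (n + 1) (a * Q + b)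
    rw [weight_eq_zero h0] at hw
    omega
  obtain ⟨c, hc, c₂, hc₂, hcc⟩ : ∃ c ∈ (zeroSlices f l)ᶜ, ∃ c₂ ∈ (zeroSlices f l)ᶜ, c ≠ c₂ := by
    refine Finset.one_lt_card.1 ?_
    rw [Finset.card_compl, hq, hl]
    omega
  rw [Finset.mem_compl] at hc hc₂
  have hker := finrank_ker hV l he
  have hwc := (weight_slice_eq hq hb hV ha h hw l he).2 c hc
  obtain ⟨g, hg, hgs⟩ := (exists_degLE_slice h hf l he).2 c hc
  rw [hl, Nat.add_sub_cancel] at hwc hg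
  obtain ⟨m, hm, s, hms⟩ : ∃ m : Module.Dual F (LinearMap.ker l), m ≠ 0 ∧
      ∃ s, ∀ u, slice f l e c u ≠ 0 → m u = s := by
    rcases ha.lt_or_eq with han | rfl
    · obtain ⟨m, hm, s, hms⟩ :=
        (ih hker han hg (by rw [weight_congr hgs, hwc])).exists_hyperplane ha0
      exact ⟨m, hm, s, fun u hu => hms u fun h0 => hu ((hgs u).1 h0)⟩
    · rw [minWeight_of_le le_rfl] at hwc
      exact exists_hyperplane_of_weight_eq_one hker ha0 hwc
  obtain ⟨u₂, hu₂⟩ := exists_slice_ne_zero he hc₂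
  obtain ⟨x₂, hlx₂, hx₂⟩ : ∃ x, l x = c₂ ∧ f x ≠ 0 := ⟨u₂ + c₂ • e, by simp [he], hu₂⟩
  have hcc' : c₂ - c ≠ 0 := sub_ne_zero.2 (Ne.symm hcc)
  -- the slope of the form `M` along `e` is chosen so that it takes one and the same value
  -- `s + μ * c` on the slice `l = c` of the support and at `x₂`
  set μ : F := (s - m (kerProj l he x₂)) / (c₂ - c) with hμ
  set M : Module.Dual F V := m ∘ₗ kerProj l he + μ • l with hM
  have hMx : ∀ x, M x = m (kerProj l he x) + μ * l x := fun x => rfl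
  have hM0 : M ≠ 0 := by
    rintro h0
    refine hm (LinearMap.ext fun u => ?_)
    have hu : kerProj l he u = u := by ext; simp
    have := hMx u
    rw [h0, hu] at this
    simpa using this.symm
  have hMx₂ : M x₂ = s + μ * c := by
    have : μ * (c₂ - c) = s - m (kerProj l he x₂) := div_mul_cancel₀ _ hcc'
    rw [hMx, hlx₂]
    linear_combination this
  refine ⟨M, hM0, ?_⟩
  obtain ⟨e', he'⟩ := exists_apply_eq_one hM0
  obtain ⟨ht, hsl⟩ := weight_slice_eq hq hb hV ha h hw M he'
  by_contra hQ
  have hnot : s + μ * c ∉ zeroSlices f M := fun h' => hx₂ (mem_zeroSlices.1 h' _ hMx₂)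
  have h1 := hsl _ hnot
  have h2 : weight (slice f M e' (s + μ * c)) ≤ minWeight (Q + 1) n (a * Q + 1) := by
    rcases ht with ht | ht | ht
    · rw [h1, ht]
      exact minWeight_mul_add_le ha hb
    · rw [h1, ht, Nat.add_sub_cancel]
    · exact absurd ht hQ
  rw [weight_slice f M he', ← hwc, weight_slice f l he] at h2
  refine absurd h2 (not_le.2 ?_)
  have hsub : {x | f x ≠ 0 ∧ l x = c} ⊂ {x | f x ≠ 0 ∧ M x = s + μ * c} := by
    refine Set.ssubset_iff_exists.2 ⟨fun x hx => ⟨hx.1, ?_⟩, x₂, ⟨hx₂, hMx₂⟩, fun hx => ?_⟩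
    · rw [hMx, hx.2, hms]
      rw [slice_kerProj f l he hx.2]
      exact hx.1
    · exact hcc (hx.2.symm.trans hlx₂)
  exact Set.ncard_lt_ncard hsub (Set.toFinite _)

/-- The theorem of Delsarte, Goethals and MacWilliams on the affine functions of minimal weight. -/
theorem hasMaximalZeros_of_weight_eq {Q n a b : ℕ} (hq : Fintype.card F = Q + 1) (hb : b < Q)
    {V : Type u} [AddCommGroup V] [Module F V] [Finite V] (hV : Module.finrank F V = n)
    (ha : a < n) {f : V → F} (h : DegLE F (a * Q + b) f)
    (hw : weight f = minWeight (Q + 1) n (a * Q + b + 1)) : HasMaximalZeros a b f := by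
  induction n generalizing V a b with
  | zero => omega
  | succ n ih =>
    have hQ : 0 < Q := by omega
    have ha' : a ≤ n := Nat.lt_succ_iff.1 ha
    have hVc : Nat.card V = (Q + 1) ^ (n + 1) := by rw [card_eq_pow hV, hq]
    have hf : ∃ x, f x ≠ 0 := by
      by_contra! h0
      have := minWeight_pos hQ (n + 1) (a * Q + b)
      rw [weight_eq_zero h0] at hw
      omega
    by_cases hk : a * Q + b = 0
    · obtain ⟨hk1, rfl⟩ := Nat.add_eq_zero_iff.1 hk
      obtain rfl := (Nat.mul_eq_zero.1 hk1).resolve_right hQ.ne'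
      rw [hk, minWeight_one Q _ hQ, ← hVc, weight_eq_card_iff] at hw
      have : Nontrivial V := Module.nontrivial_of_finrank_pos (R := F) (by omega)
      obtain ⟨y, hy⟩ := exists_ne (0 : V)
      obtain ⟨l, hl⟩ := Module.Projective.exists_dual_ne_zero F hy
      exact hasMaximalZeros_zero (l := l) (by rintro rfl; simp at hl) ∅ fun x => by simp [hw x]
    have h0 : ∃ x, f x = 0 := by
      by_contra! h'
      have := minWeight_lt_pow ha hb hk
      rw [weight_eq_card_iff.2 h'] at hw
      omega
    obtain ⟨l, hl, c, c', hcc⟩ := exists_card_section_ne hV hf h0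
    obtain ⟨e, he⟩ := exists_apply_eq_one hl
    obtain ⟨ht, hsl⟩ := weight_slice_eq hq hb hV ha' h hw l he
    have ht0 : (zeroSlices f l).card ≠ 0 := by
      intro ht0
      rw [Finset.card_eq_zero] at ht0
      refine hcc ?_
      rw [← weight_slice f l he, ← weight_slice f l he, hsl c (by simp [ht0]),
        hsl c' (by simp [ht0])]
    -- a pencil with `q - 1` zero slices: the remaining slice contains the support
    by_cases hex : ∃ m : Module.Dual F V, m ≠ 0 ∧ (zeroSlices f m).card = Q
    · obtain ⟨m, hm, hmQ⟩ := hex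
      obtain ⟨e', he'⟩ := exists_apply_eq_one hm
      obtain ⟨s, hs⟩ := exists_forall_notMem_eq (T := zeroSlices f m) (by rw [hmQ, hq]; simp)
      obtain ⟨hk', hdeg⟩ := exists_degLE_slice h hf m he'
      have hsn := (hs s).2 rfl
      obtain ⟨g, hg, hgs⟩ := hdeg s hsn
      have hws := (weight_slice_eq hq hb hV ha' h hw m he').2 s hsn
      obtain ⟨a, rfl⟩ : ∃ a', a = a' + 1 := Nat.exists_eq_succ_of_ne_zero (by rintro rfl; omega)
      rw [hmQ, show (a + 1) * Q + b - Q = a * Q + b by rw [add_mul]; omega] at hg hws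
      obtain ⟨m', T, h1, h2, h3, h4⟩ :=
        ih hb (finrank_ker hV m he') (by omega) hg (by rw [weight_congr hgs, hws])
      refine HasMaximalZeros.of_slice he' (c := s) (fun x hx => ?_)
        ⟨m', T, h1, h2, h3, fun u => by rw [← hgs, h4]⟩
      by_contra hfx
      exact hx ((hs _).1 fun h' => hfx (mem_zeroSlices.1 h' x rfl))
    -- otherwise the pencil of `l` has exactly `b` zero slices; if `a = 0`, these are all the zeros
    have htb : (zeroSlices f l).card = b := by
      rcases ht with ht | ht | ht
      · exact absurd ht ht0
      · exact ht
      · exact absurd ⟨l, hl, ht⟩ hex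
    rcases Nat.eq_zero_or_pos a with rfl | ha0
    · rw [← htb]
      refine hasMaximalZeros_zero hl (zeroSlices f l) fun x =>
        ⟨fun hx => ?_, fun hx => mem_zeroSlices.1 hx x rfl⟩
      by_contra hlx
      have := hsl _ hlx
      rw [htb, zero_mul, zero_add, Nat.sub_self, zero_add, minWeight_one Q _ hQ, ← hq,
        ← card_eq_pow (V := LinearMap.ker l) (finrank_ker hV l he), weight_eq_card_iff] at this
      exact this (kerProj l he x) (by rw [slice_kerProj f l he rfl, hx])
    · refine absurd (exists_card_zeroSlices_eq hq hb hV ha' ha0 h hw ?_ he htb) hex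
      intro W _ _ _ hW g han hg hgw
      exact ih (b := 0) hQ hW han hg hgw

end Extremal

/-! ### Functions whose zero set is a cone -/

section Cone

variable {F : Type*} [Field F] [Fintype F]

/-- If `f` vanishes on the hyperplane `l = 0`, then after division by `l` the affine bound for the
degree `k` applies to the `q - 1` other slices, none of which is zero by homogeneity. -/
theorem weight_cone_of_hyperplane {Q n k : ℕ} (hq : Fintype.card F = Q + 1)
    {V : Type u} [AddCommGroup V] [Module F V] [Finite V] (hV : Module.finrank F V = n + 1)
    {f : V → F} (h : DegLE F (k + 1) f) (hf : ∃ x, f x ≠ 0)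
    (hs : ∀ c : F, c ≠ 0 → ∀ x, f (c • x) = 0 ↔ f x = 0) {l : Module.Dual F V} (hl : l ≠ 0)
    (hlf : ∀ x, l x = 0 → f x = 0) : Q * minWeight (Q + 1) n (k + 1) ≤ weight f := by
  classical
  obtain ⟨e, he⟩ := exists_apply_eq_one hl
  have hZ : zeroSlices f l = {0} := by
    ext c
    rw [mem_zeroSlices, Finset.mem_singleton]
    refine ⟨fun hc => ?_, ?_⟩
    · by_contra hc0
      obtain ⟨x, hx⟩ := hf
      have hlx : l x ≠ 0 := fun h0 => hx (hlf x h0)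
      exact hx ((hs (c / l x) (div_ne_zero hc0 hlx) x).1 (hc _ (by simp [hlx])))
    · rintro rfl
      exact hlf
  have hdeg := (exists_degLE_slice h hf l he).2
  rw [hZ, Finset.card_singleton, Nat.add_sub_cancel] at hdeg
  calc Q * minWeight (Q + 1) n (k + 1)
      = ({0}ᶜ : Finset F).card • minWeight (Q + 1) n (k + 1) := by
        rw [Finset.card_compl, hq, Finset.card_singleton, Nat.add_sub_cancel, smul_eq_mul]
    _ ≤ ∑ c ∈ ({0}ᶜ : Finset F), weight (slice f l e c) := by
        refine Finset.card_nsmul_le_sum _ _ _ fun c hc => ?_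
        rw [Finset.mem_compl] at hc
        obtain ⟨g, hg, hgs⟩ := hdeg c hc
        rw [← hZ] at hc
        obtain ⟨u, hu⟩ := exists_slice_ne_zero he hc
        rw [← weight_congr hgs, ← hq]
        exact le_weight (finrank_ker hV l he) hg ⟨u, fun h0 => hu ((hgs u).1 h0)⟩
    _ = weight f := by rw [weight_eq_sum_compl f l he, hZ]

/-- The bound for cones, with strict inequality if no linear hyperplane consists of zeros. In the
latter case every linear hyperplane satisfies the bound in dimension one less, and averaging over
all of them wins a factor larger than `q`. -/
theorem weight_cone {Q n k : ℕ} (hq : Fintype.card F = Q + 1)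
    {V : Type u} [AddCommGroup V] [Module F V] [Finite V] (hV : Module.finrank F V = n + 1)
    {f : V → F} (h : DegLE F (k + 1) f) (hf : ∃ x, f x ≠ 0)
    (hs : ∀ c : F, c ≠ 0 → ∀ x, f (c • x) = 0 ↔ f x = 0) (h0 : f 0 = 0) :
    Q * minWeight (Q + 1) n (k + 1) ≤ weight f ∧
      ((∀ l : Module.Dual F V, l ≠ 0 → ∃ x, l x = 0 ∧ f x ≠ 0) →
        Q * minWeight (Q + 1) n (k + 1) < weight f) := by
  classical
  have hQ : 0 < Q := by have := one_lt_q (F := F); omega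
  suffices hstrict : (∀ l : Module.Dual F V, l ≠ 0 → ∃ x, l x = 0 ∧ f x ≠ 0) →
      Q * minWeight (Q + 1) n (k + 1) < weight f by
    refine ⟨?_, hstrict⟩
    by_cases hl : ∀ l : Module.Dual F V, l ≠ 0 → ∃ x, l x = 0 ∧ f x ≠ 0
    · exact (hstrict hl).le
    · push Not at hl
      obtain ⟨l, hl, hlf⟩ := hl
      exact weight_cone_of_hyperplane hq hV h hf hs hl hlf
  intro hl
  induction n generalizing V with
  | zero =>
    have : Nontrivial V := Module.nontrivial_of_finrank_pos (R := F) (by omega)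
    obtain ⟨y, hy⟩ := exists_ne (0 : V)
    obtain ⟨l, hly⟩ := Module.Projective.exists_dual_ne_zero F hy
    have hl0 : l ≠ 0 := by rintro rfl; simp at hly
    obtain ⟨e, he⟩ := exists_apply_eq_one hl0
    have hbot : LinearMap.ker l = ⊥ := Submodule.finrank_eq_zero.1 (finrank_ker hV l he)
    obtain ⟨x, hx, hfx⟩ := hl l hl0
    have hx0 : x ∈ LinearMap.ker l := hx
    rw [hbot, Submodule.mem_bot] at hx0
    exact absurd h0 (hx0 ▸ hfx)
  | succ n ih =>
    have hfin : Finite (Module.Dual F V) := Module.finite_of_finite F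
    have := Fintype.ofFinite (Module.Dual F V)
    have hD : Fintype.card (Module.Dual F V) = (Q + 1) ^ (n + 1 + 1) := by
      rw [← Nat.card_eq_fintype_card, ← hq]
      exact card_eq_pow (by rw [Subspace.dual_finrank_eq, hV])
    have hsec (l : Module.Dual F V) (hl0 : l ≠ 0) :
        Q * minWeight (Q + 1) n (k + 1) ≤ Nat.card {x // f x ≠ 0 ∧ l x = l 0} := by
      obtain ⟨e, he⟩ := exists_apply_eq_one hl0
      rw [map_zero, ← weight_slice f l he]
      have hg := h.slice l e 0
      have hgs : ∀ c : F, c ≠ 0 → ∀ u, slice f l e 0 (c • u) = 0 ↔ slice f l e 0 u = 0 :=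
        fun c hc u => by simpa [slice] using hs c hc u
      have hg0 : slice f l e 0 0 = 0 := by simpa [slice] using h0
      have hgf : ∃ u, slice f l e 0 u ≠ 0 := by
        obtain ⟨x, hx, hfx⟩ := hl l hl0
        exact ⟨kerProj l he x, by rwa [slice_kerProj f l he hx]⟩
      by_cases hm : ∀ m : Module.Dual F (LinearMap.ker l), m ≠ 0 →
          ∃ u, m u = 0 ∧ slice f l e 0 u ≠ 0
      · exact (ih (finrank_ker hV l he) hg hgf hgs hg0 hm).le
      · push Not at hm
        obtain ⟨m, hm, hmf⟩ := hm
        exact weight_cone_of_hyperplane hq (finrank_ker hV l he) hg hgf hgs hm hmf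
    -- the zero form is set apart: it contributes `weight f` to the sum over all linear forms
    have hsum := sum_card_section hV f 0
    rw [if_pos h0, add_zero, hq, ← Finset.add_sum_erase _ _ (Finset.mem_univ 0)] at hsum
    have hle := Finset.card_nsmul_le_sum (Finset.univ.erase (0 : Module.Dual F V)) _ _
      fun l hl => hsec l (Finset.ne_of_mem_erase hl)
    rw [Finset.card_erase_of_mem (Finset.mem_univ _), Finset.card_univ, hD, smul_eq_mul] at hle
    have hw : Nat.card {x // f x ≠ 0 ∧ (0 : Module.Dual F V) x = (0 : Module.Dual F V) 0} =
        weight f := by simp [weight]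
    rw [hw] at hsum
    set w := Q * minWeight (Q + 1) n (k + 1) with hwdef
    have hwpos : 0 < w := Nat.mul_pos hQ (minWeight_pos hQ _ _)
    have hq1 : Q * minWeight (Q + 1) (n + 1) (k + 1) ≤ (Q + 1) * w := by
      have := minWeight_succ_le' hQ (n := n) (k := k) (t := 0) (by omega) (by omega)
      rw [Nat.sub_zero, Nat.sub_zero] at this
      calc _ ≤ Q * ((Q + 1) * minWeight (Q + 1) n (k + 1)) := Nat.mul_le_mul_left _ this
        _ = _ := by rw [hwdef]; ring
    refine lt_of_le_of_lt hq1 ?_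
    by_contra hcon
    obtain ⟨P, hP⟩ : ∃ P, (Q + 1) ^ (n + 1) = P + 1 :=
      Nat.exists_eq_succ_of_ne_zero (by positivity)
    have hP2 : (Q + 1) ^ (n + 1 + 1) - 1 = (P + 1) * (Q + 1) - 1 := by rw [pow_succ, hP]
    have hP3 : (P + 1) * (Q + 1) - 1 = P * (Q + 1) + Q := by
      have : (P + 1) * (Q + 1) = P * (Q + 1) + Q + 1 := by ring
      omega
    rw [hP2, hP3] at hle
    rw [hP] at hsum
    have h1 : (P * (Q + 1) + Q) * w ≤ weight f * P := by
      have : weight f * (P + 1) = weight f * P + weight f := by ring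
      omega
    have h2 : weight f * P ≤ (Q + 1) * w * P := Nat.mul_le_mul_right _ (not_lt.1 hcon)
    have h3 : 0 < Q * w := Nat.mul_pos hQ hwpos
    nlinarith

end Cone

/-! ### The weight of maximal affine hypersurfaces -/

section Maximal

variable {F : Type*} [Field F]

theorem pi_surjective_of_linearIndependent {V : Type*} [AddCommGroup V] [Module F V]
    {ι : Type*} [Finite ι] {l : ι → Module.Dual F V} (hl : LinearIndependent F l) :
    Function.Surjective (LinearMap.pi l) := by
  classical
  have := Fintype.ofFinite ι
  rw [← LinearMap.dualMap_injective_iff, injective_iff_map_eq_zero]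
  intro ψ hψ
  have h1 : ∑ i, ψ (Pi.single i 1) • l i = 0 := by
    rw [← hψ]
    ext x
    rw [LinearMap.dualMap_apply, LinearMap.pi_apply_eq_sum_univ ψ]
    have hsingle : ∀ i : ι, (Pi.single i 1 : ι → F) = fun j => if i = j then 1 else 0 := fun i => by
      ext j
      simp [Pi.single_apply, eq_comm]
    simp [mul_comm, hsingle]
  refine LinearMap.pi_ext' fun i => LinearMap.ext_ring ?_
  simpa using Fintype.linearIndependent_iff.1 hl _ h1 i

theorem weight_eq_of_hasMaximalZeros [Fintype F] {V : Type*} [AddCommGroup V] [Module F V]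
    [Finite V] {Q n a b : ℕ} (hq : Fintype.card F = Q + 1) (hb : b < Q)
    (hV : Module.finrank F V = n) {f : V → F} (h : HasMaximalZeros a b f) :
    weight f = minWeight (Q + 1) n (a * Q + b + 1) := by
  classical
  obtain ⟨l, T, hl, hT, hTb, hf⟩ := h
  have han : a + 1 ≤ n := by
    have := hl.fintype_card_le_finrank
    rwa [Fintype.card_fin, Subspace.dual_finrank_eq, hV] at this
  have hsurj := pi_surjective_of_linearIndependent hl
  obtain ⟨s, hsr⟩ := (LinearMap.pi l).exists_rightInverse_of_surjective
    (LinearMap.range_eq_top.2 hsurj)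
  have hs : ∀ y, LinearMap.pi l (s y) = y := fun y => LinearMap.congr_fun hsr y
  have hker : Module.finrank F (LinearMap.ker (LinearMap.pi l)) = n - a - 1 := by
    have h1 := (LinearMap.pi l).finrank_range_add_finrank_ker
    rw [LinearMap.range_eq_top.2 hsurj, finrank_top, Module.finrank_fin_fun, hV] at h1
    omega
  have hmem : ∀ x, f x ≠ 0 ↔ LinearMap.pi l x ∈ Fintype.piFinset fun i => (T i)ᶜ := fun x => by
    simp [hf]
  have hcard : weight f = Nat.card ({y // y ∈ Fintype.piFinset fun i => (T i)ᶜ} ×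
      LinearMap.ker (LinearMap.pi l)) :=
    Nat.card_congr
      { toFun := fun x => (⟨LinearMap.pi l x.1, (hmem _).1 x.2⟩,
          ⟨x.1 - s (LinearMap.pi l x.1), by rw [LinearMap.mem_ker, map_sub, hs, sub_self]⟩)
        invFun := fun y => ⟨y.2 + s y.1, by
          rw [hmem, map_add, hs, LinearMap.mem_ker.1 y.2.2, zero_add]; exact y.1.2⟩
        left_inv := fun x => by ext; simp
        right_inv := fun y => by
          have : LinearMap.pi l (y.2 + s y.1) = y.1 := by
            rw [map_add, hs, LinearMap.mem_ker.1 y.2.2, zero_add]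
          refine Prod.ext (Subtype.ext this) (Subtype.ext ?_)
          simp only [this, add_sub_cancel_right] }
  rw [hcard, Nat.card_prod, card_eq_pow hker, Nat.card_eq_fintype_card, Fintype.card_coe,
    Fintype.card_piFinset, Fin.prod_univ_castSucc, minWeight_of_lt han hb]
  simp [Finset.card_compl, hT, hTb, hq]

theorem isMaximalAffine_iff [Fintype F] {n k : ℕ} {g : (Fin n → F) → F} :
    IsMaximalAffine k {x | g x = 0} ↔ ∃ a b, k = a * (Fintype.card F - 1) + b ∧
      b < Fintype.card F - 1 ∧ HasMaximalZeros a b g := by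
  simp only [IsMaximalAffine, HasMaximalZeros, Set.ext_iff, Set.mem_iUnion, Set.mem_ofPred_eq,
    exists_prop, exists_eq_right']

end Maximal

/-! ### Homogeneous polynomials and projective space -/

section Polynomial

variable {F : Type*} [Field F]

theorem DegLE.sum {V : Type*} [AddCommGroup V] [Module F V] {k : ℕ} {ι : Type*} (s : Finset ι)
    {f : ι → V → F} (h : ∀ i ∈ s, DegLE F k (f i)) : DegLE F k fun x => ∑ i ∈ s, f i x := by
  classical
  induction s using Finset.induction_on with
  | empty => simpa using DegLE.const k (0 : F)
  | insert i s hi ih =>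
    simp only [Finset.sum_insert hi]
    exact (h i (by simp)).add (ih fun j hj => h j (Finset.mem_insert_of_mem hj))

theorem DegLE.pow_mul {V : Type*} [AddCommGroup V] [Module F V] {k : ℕ} {f : V → F}
    (h : DegLE F k f) (l : Module.Dual F V) (j : ℕ) : DegLE F (j + k) fun x => l x ^ j * f x := by
  induction j with
  | zero => simpa using h
  | succ j ih => simpa only [pow_succ', mul_assoc, Nat.add_right_comm] using ih.mul l

theorem degLE_eval {n d : ℕ} {f : MvPolynomial (Fin n) F} (hf : f.IsHomogeneous d) :
    DegLE F d fun x : Fin n → F => MvPolynomial.eval x f := by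
  simp only [MvPolynomial.eval_eq]
  refine DegLE.sum _ fun m hm => DegLE.smul ?_ _
  have hd : ∑ i ∈ m.support, m i = d := by
    have := hf (MvPolynomial.mem_support_iff.mp hm)
    simpa [Finsupp.weight_apply, Finsupp.sum] using this
  rw [← hd]
  induction m.support using Finset.induction_on with
  | empty => simpa using DegLE.const 0 (1 : F)
  | insert i s hi ih =>
    simp only [Finset.sum_insert hi, Finset.prod_insert hi]
    exact ih.pow_mul (LinearMap.proj i) (m i)

theorem eval_smul {n d : ℕ} {f : MvPolynomial (Fin n) F} (hf : f.IsHomogeneous d) (c : F)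
    (x : Fin n → F) : MvPolynomial.eval (c • x) f = c ^ d * MvPolynomial.eval x f := by
  simp only [MvPolynomial.eval_eq, Finset.mul_sum]
  refine Finset.sum_congr rfl fun m hm => ?_
  have hd : ∑ i ∈ m.support, m i = d := by
    have := hf (MvPolynomial.mem_support_iff.mp hm)
    simpa [Finsupp.weight_apply, Finsupp.sum] using this
  simp only [Pi.smul_apply, smul_eq_mul, mul_pow, Finset.prod_mul_distrib,
    Finset.prod_pow_eq_pow_sum, hd]
  ring

theorem eval_zero_eq_zero {n d : ℕ} {f : MvPolynomial (Fin n) F} (hf : f.IsHomogeneous d)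
    (hd : 1 ≤ d) : MvPolynomial.eval 0 f = 0 := by
  have := eval_smul hf 0 0
  rwa [smul_zero, zero_pow (by omega), zero_mul] at this

theorem eval_smul_eq_zero_iff {n d : ℕ} {f : MvPolynomial (Fin n) F} (hf : f.IsHomogeneous d)
    {c : F} (hc : c ≠ 0) (x : Fin n → F) :
    MvPolynomial.eval (c • x) f = 0 ↔ MvPolynomial.eval x f = 0 := by
  rw [eval_smul hf, mul_eq_zero]
  simp [hc]

end Polynomial

section Projective

variable {F : Type*} [Field F]

theorem weight_eval_eq [Fintype F] {n d : ℕ} {f : MvPolynomial (Fin (n + 1)) F}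
    (hf : f.IsHomogeneous d) (hd : 1 ≤ d) :
    weight (fun x => MvPolynomial.eval x f) = (Fintype.card F - 1) * (projZeros f)ᶜ.ncard := by
  have hu : Nat.card Fˣ = Fintype.card F - 1 := by
    rw [Nat.card_units, Nat.card_eq_fintype_card]
  rw [← hu, ← Nat.card_coe_set_eq, mul_comm, ← Nat.card_prod]
  refine (Nat.card_congr (Equiv.ofBijective (fun y : ((projZeros f)ᶜ : Set _) × Fˣ =>
    (⟨(y.2 : F) • y.1.1.rep, fun h0 => y.1.2 ((eval_smul_eq_zero_iff hf y.2.ne_zero _).1 h0)⟩ :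
      {x // MvPolynomial.eval x f ≠ 0})) ⟨?_, ?_⟩)).symm
  · rintro ⟨⟨p, hp⟩, u⟩ ⟨⟨p', hp'⟩, u'⟩ h
    have h1 : (u : F) • p.rep = (u' : F) • p'.rep := Subtype.mk.inj h
    obtain rfl : p = p' := by
      rw [← p.mk_rep, ← p'.mk_rep, Projectivization.mk_eq_mk_iff]
      refine ⟨u⁻¹ * u', ?_⟩
      rw [mul_smul, Units.smul_def u', ← h1, ← Units.smul_def, inv_smul_smul]
    obtain rfl : u = u' := Units.ext (smul_left_injective F p.rep_nonzero h1)
    rfl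
  · rintro ⟨x, hx⟩
    have hx0 : x ≠ 0 := by
      rintro rfl
      exact hx (eval_zero_eq_zero hf hd)
    obtain ⟨a, ha⟩ := Projectivization.exists_smul_eq_mk_rep F x hx0
    refine ⟨⟨⟨Projectivization.mk F x hx0, fun h => hx ((mk_mem_projZeros hf x hx0).1 h)⟩, a⁻¹⟩, ?_⟩
    refine Subtype.ext ?_
    change ((a⁻¹ : Fˣ) : F) • (Projectivization.mk F x hx0).rep = x
    rw [← ha, ← Units.smul_def, inv_smul_smul]

theorem zerosBound_eq [Fintype F] (n d : ℕ) : zerosBound (Fintype.card F) n d =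
    (Nat.card (PSpace F n) : ℚ) - minWeight (Fintype.card F) n d := by
  have h1 : (1 : ℚ) < Fintype.card F := by exact_mod_cast one_lt_q (F := F)
  have h := Projectivization.card' F (Fin (n + 1) → F)
  rw [card_eq_pow (Module.finrank_fin_fun F), Nat.card_eq_fintype_card (α := F)] at h
  have h2 : (Fintype.card F : ℚ) ^ (n + 1) =
      Nat.card (PSpace F n) * ((Fintype.card F : ℚ) - 1) + 1 := by
    rw [← Nat.cast_pred Fintype.card_pos]
    exact_mod_cast h
  rw [zerosBound, h2, add_sub_cancel_right, mul_div_cancel_right₀ _ (sub_pos.2 h1).ne']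

theorem ncard_projZeros [Fintype F] {n : ℕ} (f : MvPolynomial (Fin (n + 1)) F) :
    ((projZeros f).ncard : ℚ) = Nat.card (PSpace F n) - ((projZeros f)ᶜ.ncard : ℚ) := by
  rw [← Set.ncard_add_ncard_compl (projZeros f)]
  push_cast
  ring

theorem affineChart_injective {n : ℕ} (e : (Fin (n + 1) → F) ≃ₗ[F] (Fin (n + 1) → F)) :
    Function.Injective (affineChart e) := by
  intro x y h
  rw [affineChart, affineChart, Projectivization.mk_eq_mk_iff'] at h
  obtain ⟨a, ha⟩ := h
  rw [← map_smul, e.symm.injective.eq_iff] at ha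
  obtain rfl : a = 1 := by simpa using congrFun ha 0
  rw [one_smul] at ha
  exact ((Fin.cons_injective2 ha).2).symm

theorem range_affineChart {n : ℕ} (e : (Fin (n + 1) → F) ≃ₗ[F] (Fin (n + 1) → F)) :
    Set.range (affineChart e) = {p | e p.rep 0 = 0}ᶜ := by
  ext p
  rw [Set.mem_range, Set.mem_compl_iff, Set.mem_ofPred_eq]
  constructor
  · rintro ⟨x, rfl⟩
    obtain ⟨a, ha⟩ := Projectivization.exists_smul_eq_mk_rep F (e.symm (Fin.cons 1 x)) (by
      intro h
      have h1 : (Fin.cons 1 x : Fin (n + 1) → F) = 0 := by simpa using h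
      simpa using congrFun h1 0)
    rw [affineChart, ← ha, Units.smul_def, map_smul]
    simp
  · intro hp
    refine ⟨Fin.tail ((e p.rep 0)⁻¹ • e p.rep), ?_⟩
    have hcons : (Fin.cons 1 (Fin.tail ((e p.rep 0)⁻¹ • e p.rep)) : Fin (n + 1) → F) =
        (e p.rep 0)⁻¹ • e p.rep := by
      have h1 : (1 : F) = ((e p.rep 0)⁻¹ • e p.rep) 0 := by simp [hp]
      conv_lhs => rw [h1]
      exact Fin.cons_self_tail _
    conv_rhs => rw [← p.mk_rep]
    rw [affineChart, Projectivization.mk_eq_mk_iff']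
    exact ⟨(e p.rep 0)⁻¹, by rw [hcons, map_smul, e.symm_apply_apply]⟩

/-- The polynomial `f` read in the affine coordinates given by `e`. -/
noncomputable def dehomogenize {n : ℕ} (f : MvPolynomial (Fin (n + 1)) F)
    (e : (Fin (n + 1) → F) ≃ₗ[F] (Fin (n + 1) → F)) (x : Fin n → F) : F :=
  MvPolynomial.eval (e.symm (Fin.cons 1 x)) f

theorem affineChart_mem_projZeros {n d : ℕ} {f : MvPolynomial (Fin (n + 1)) F}
    (hf : f.IsHomogeneous d) (e : (Fin (n + 1) → F) ≃ₗ[F] (Fin (n + 1) → F)) (x : Fin n → F) :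
    affineChart e x ∈ projZeros f ↔ dehomogenize f e x = 0 :=
  mk_mem_projZeros hf _ _

theorem ncard_compl_projZeros {n d : ℕ} {f : MvPolynomial (Fin (n + 1)) F}
    (hf : f.IsHomogeneous d) {e : (Fin (n + 1) → F) ≃ₗ[F] (Fin (n + 1) → F)} {H : Set (PSpace F n)}
    (hH : Set.range (affineChart e) = Hᶜ) (hHZ : H ⊆ projZeros f) :
    (projZeros f)ᶜ.ncard = weight (dehomogenize f e) := by
  have himage : (projZeros f)ᶜ = affineChart e '' {x | dehomogenize f e x ≠ 0} := by
    ext p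
    constructor
    · intro hp
      obtain ⟨x, rfl⟩ : p ∈ Set.range (affineChart e) := by
        rw [hH]
        exact fun h => hp (hHZ h)
      exact ⟨x, fun h => hp ((affineChart_mem_projZeros hf e x).2 h), rfl⟩
    · rintro ⟨x, hx, rfl⟩ h
      exact hx ((affineChart_mem_projZeros hf e x).1 h)
  rw [himage, Set.ncard_image_of_injective _ (affineChart_injective e)]
  rfl

/-- Every nonzero linear form is the first coordinate of a coordinate system. -/
theorem exists_equiv_apply_zero {n : ℕ} {l : Module.Dual F (Fin (n + 1) → F)} (hl : l ≠ 0) :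
    ∃ e : (Fin (n + 1) → F) ≃ₗ[F] (Fin (n + 1) → F), ∀ v, e v 0 = l v := by
  obtain ⟨v₀, hv₀⟩ := exists_apply_eq_one hl
  have hker : Module.finrank F (LinearMap.ker l) = Module.finrank F (Fin n → F) := by
    rw [finrank_ker (Module.finrank_fin_fun F) l hv₀, Module.finrank_fin_fun]
  let ψ := LinearEquiv.ofFinrankEq (LinearMap.ker l) (Fin n → F) hker
  let L : (Fin (n + 1) → F) →ₗ[F] (Fin (n + 1) → F) :=
    LinearMap.pi (Fin.cons l fun i => LinearMap.proj i ∘ₗ ψ.toLinearMap ∘ₗ kerProj l hv₀)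
  have hinj : Function.Injective L := by
    rw [injective_iff_map_eq_zero]
    intro v hv
    have h0 : l v = 0 := congrFun hv 0
    have h1 : ψ (kerProj l hv₀ v) = 0 := funext fun i => congrFun hv i.succ
    have h2 : kerProj l hv₀ v = 0 := by simpa using h1
    simpa [h0] using congrArg Subtype.val h2
  exact ⟨LinearEquiv.ofInjectiveEndo L hinj, fun v => rfl⟩

theorem degLE_dehomogenize {n k : ℕ} {f : MvPolynomial (Fin (n + 1)) F}
    (hf : f.IsHomogeneous (k + 1)) {e : (Fin (n + 1) → F) ≃ₗ[F] (Fin (n + 1) → F)}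
    (h0 : ∃ x, MvPolynomial.eval x f ≠ 0) (he : ∀ v, e v 0 = 0 → MvPolynomial.eval v f = 0) :
    DegLE F k (dehomogenize f e) := by
  have hone : (LinearMap.proj 0 ∘ₗ e.toLinearMap : Module.Dual F (Fin (n + 1) → F))
      (e.symm (Pi.single 0 1)) = 1 := by simp
  obtain ⟨-, g, hg, hfg⟩ := (degLE_eval hf).exists_eq_mul h0 _ hone 0 he
  let φ : (Fin n → F) →ₗ[F] (Fin (n + 1) → F) :=
    e.symm.toLinearMap ∘ₗ LinearMap.pi (Fin.cons 0 fun i => LinearMap.proj i)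
  have hφ : ∀ x, e.symm (Fin.cons 1 x) = φ x + e.symm (Pi.single 0 1) := by
    intro x
    rw [LinearMap.comp_apply, LinearEquiv.coe_coe, ← map_add]
    congr 1
    ext i
    refine Fin.cases ?_ (fun j => ?_) i <;> simp
  have heq : dehomogenize f e = fun x => g (φ x + e.symm (Pi.single 0 1)) := by
    ext x
    rw [dehomogenize, hfg, ← hφ]
    simp
  rw [heq]
  exact hg.comp_affine _ _

end Projective

/-! ### Extremal homogeneous polynomials -/

section Existence

/-- The number `minWeight` counts the points of a grid in `F^n` obtained by excluding `t i` values
of the `i`-th coordinate, which takes a product of `∑ i, t i` affine functions. -/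
theorem exists_prod_eq_minWeight {Q : ℕ} (hQ : 0 < Q) (n k : ℕ) : ∃ t : Fin n → ℕ,
    (∀ i, t i ≤ Q) ∧ ∑ i, t i ≤ k ∧ ∏ i, (Q + 1 - t i) = minWeight (Q + 1) n (k + 1) := by
  induction n generalizing k with
  | zero => exact ⟨Fin.elim0, fun i => i.elim0, by simp, by simp [minWeight_of_le]⟩
  | succ n ih =>
    rcases lt_or_ge k Q with h | h
    · refine ⟨Fin.cons k fun _ => 0, fun i => Fin.cases h.le (fun _ => Nat.zero_le _) i,
        by simp [Fin.sum_univ_succ], ?_⟩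
      have := minWeight_of_lt (n := n + 1) (a := 0) (b := k) (by omega) h
      rw [zero_mul, zero_add] at this
      simp [Fin.prod_univ_succ, this]
    · obtain ⟨t, ht, hsum, hprod⟩ := ih (k - Q)
      refine ⟨Fin.cons Q t, fun i => Fin.cases le_rfl ht i, ?_, ?_⟩
      · simp only [Fin.sum_univ_succ, Fin.cons_zero, Fin.cons_succ]
        omega
      · simp only [Fin.prod_univ_succ, Fin.cons_zero, Fin.cons_succ, hprod, minWeight,
          Nat.add_sub_cancel, Nat.add_sub_cancel_left, one_mul]
        rw [Nat.mod_eq_sub_mod h, Nat.div_eq_sub_div hQ h, add_mul]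
        congr 1
        · simp only [eq_iff_iff]
          omega
        · congr 2
          omega

variable {F : Type*} [Field F] [Fintype F]

/-- Equality is attained by products of linear forms. -/
theorem exists_ncard_compl_eq (n k : ℕ) : ∃ f : MvPolynomial (Fin (n + 1)) F,
    f.IsHomogeneous (k + 1) ∧ (projZeros f)ᶜ.ncard = minWeight (Fintype.card F) n (k + 1) := by
  classical
  obtain ⟨Q, hq⟩ : ∃ Q, Fintype.card F = Q + 1 := Nat.exists_eq_succ_of_ne_zero Fintype.card_ne_zero
  have hQ : 0 < Q := by have := one_lt_q (F := F); omega
  obtain ⟨t, ht, hsum, hprod⟩ := exists_prod_eq_minWeight hQ n k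
  have hT (i : Fin n) : ∃ T : Finset F, T.card = t i := by
    obtain ⟨T, -, hT⟩ := Finset.exists_subset_card_eq (s := (Finset.univ : Finset F)) (n := t i)
      (by rw [Finset.card_univ, hq]; exact (ht i).trans (Nat.le_succ _))
    exact ⟨T, hT⟩
  choose T hT using hT
  set f : MvPolynomial (Fin (n + 1)) F := MvPolynomial.X 0 ^ (k + 1 - ∑ i, t i) *
    ∏ i, ∏ c ∈ T i, (MvPolynomial.X i.succ - MvPolynomial.C c * MvPolynomial.X 0) with hfdef
  have hf : f.IsHomogeneous (k + 1) := by
    have h1 : (∏ i, ∏ c ∈ T i, (MvPolynomial.X i.succ - MvPolynomial.C c * MvPolynomial.X 0 :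
        MvPolynomial (Fin (n + 1)) F)).IsHomogeneous (∑ i, t i) := by
      refine MvPolynomial.IsHomogeneous.prod _ _ _ fun i _ => ?_
      have := MvPolynomial.IsHomogeneous.prod (T i) (fun c => (MvPolynomial.X i.succ -
        MvPolynomial.C c * MvPolynomial.X 0 : MvPolynomial (Fin (n + 1)) F)) (fun _ => 1)
        fun c _ => (MvPolynomial.isHomogeneous_X F i.succ).sub
          (by simpa using (MvPolynomial.isHomogeneous_C _ c).mul (MvPolynomial.isHomogeneous_X F 0))
      simpa [hT] using this
    have h2 := ((MvPolynomial.isHomogeneous_X F (0 : Fin (n + 1))).pow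
      (k + 1 - ∑ i, t i)).mul h1
    rwa [one_mul, Nat.sub_add_cancel (by omega)] at h2
  refine ⟨f, hf, ?_⟩
  rw [ncard_compl_projZeros hf (e := LinearEquiv.refl F _) (by rw [range_affineChart]), hq, ← hprod]
  · have hg : ∀ x, dehomogenize f (LinearEquiv.refl F _) x ≠ 0 ↔
        x ∈ Fintype.piFinset fun i => (T i)ᶜ := by
      intro x
      simp only [dehomogenize, hfdef, map_mul, map_pow, map_prod, map_sub, MvPolynomial.eval_X,
        MvPolynomial.eval_C, LinearEquiv.refl_symm, LinearEquiv.refl_apply, Fin.cons_zero,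
        Fin.cons_succ, one_pow, one_mul, mul_one, Finset.prod_ne_zero_iff, Finset.mem_univ,
        forall_true_left, Fintype.mem_piFinset, Finset.mem_compl, sub_ne_zero]
      exact forall_congr' fun i => ⟨fun h hx => h _ hx rfl, fun h c hc hx => h (hx ▸ hc)⟩
    rw [weight, Nat.card_congr (Equiv.subtypeEquivRight hg), Nat.card_eq_fintype_card,
      Fintype.card_coe, Fintype.card_piFinset]
    simp [Finset.card_compl, hT, hq]
  · intro p hp
    have hp0 : p.rep 0 = 0 := hp
    have hpos : k + 1 - ∑ i, t i ≠ 0 := by omega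
    simp [projZeros, hfdef, hp0, hpos]

end Existence
end ProjRM

theorem mainTheorem2 {F : Type*} [Field F] [Fintype F] (n d : ℕ) (hn : 1 ≤ n) (hd : 1 ≤ d) :
    (∀ f : MvPolynomial (Fin (n + 1)) F, f.IsHomogeneous d → ProjRM.projZeros f ≠ Set.univ →
      ((ProjRM.projZeros f).ncard : ℚ) ≤ ProjRM.zerosBound (Fintype.card F) n d) ∧
    (∃ f : MvPolynomial (Fin (n + 1)) F, f.IsHomogeneous d ∧ ProjRM.projZeros f ≠ Set.univ ∧
      ((ProjRM.projZeros f).ncard : ℚ) = ProjRM.zerosBound (Fintype.card F) n d) ∧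
    (d ≤ n * (Fintype.card F - 1) →
      ∀ f : MvPolynomial (Fin (n + 1)) F, f.IsHomogeneous d → ProjRM.projZeros f ≠ Set.univ →
        (((ProjRM.projZeros f).ncard : ℚ) = ProjRM.zerosBound (Fintype.card F) n d ↔
          ∃ H : Set (ProjRM.PSpace F n), ProjRM.IsHyperplane H ∧ H ⊆ ProjRM.projZeros f ∧
            ProjRM.IsMaximalOffHyperplane (d - 1) H (ProjRM.projZeros f))) := by
  open ProjRM in
  obtain ⟨k, rfl⟩ : ∃ k, d = k + 1 := Nat.exists_eq_succ_of_ne_zero (by omega)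
  obtain ⟨Q, hq⟩ : ∃ Q, Fintype.card F = Q + 1 := Nat.exists_eq_succ_of_ne_zero Fintype.card_ne_zero
  have hQ : 0 < Q := by have := one_lt_q (F := F); omega
  have hV : Module.finrank F (Fin (n + 1) → F) = n + 1 := Module.finrank_fin_fun F
  have hle (f : MvPolynomial (Fin (n + 1)) F) :
      ((projZeros f).ncard : ℚ) ≤ zerosBound (Fintype.card F) n (k + 1) ↔
        minWeight (Fintype.card F) n (k + 1) ≤ (projZeros f)ᶜ.ncard := by
    rw [ncard_projZeros, zerosBound_eq, sub_le_sub_iff_left, Nat.cast_le]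
  have heq (f : MvPolynomial (Fin (n + 1)) F) :
      ((projZeros f).ncard : ℚ) = zerosBound (Fintype.card F) n (k + 1) ↔
        (projZeros f)ᶜ.ncard = minWeight (Fintype.card F) n (k + 1) := by
    rw [ncard_projZeros, zerosBound_eq, sub_right_inj, Nat.cast_inj]
  have hne {f : MvPolynomial (Fin (n + 1)) F} (hZ : projZeros f ≠ Set.univ) :
      ∃ x, MvPolynomial.eval x f ≠ 0 := by
    obtain ⟨p, hp⟩ := (Set.ne_univ_iff_exists_notMem _).1 hZ
    exact ⟨p.rep, hp⟩
  have hcone {f : MvPolynomial (Fin (n + 1)) F} (hf : f.IsHomogeneous (k + 1))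
      (hZ : projZeros f ≠ Set.univ) :=
    weight_cone hq hV (degLE_eval hf) (hne hZ) (fun c hc x => eval_smul_eq_zero_iff hf hc x)
      (eval_zero_eq_zero hf hd)
  refine ⟨fun f hf hZ => ?_, ?_, fun hdn f hf hZ => ?_⟩
  · have h := (hcone hf hZ).1
    rw [weight_eval_eq hf hd, hq, Nat.add_sub_cancel] at h
    rw [hle, hq]
    exact Nat.le_of_mul_le_mul_left h hQ
  · obtain ⟨f, hf, hcard⟩ := exists_ncard_compl_eq (F := F) n k
    refine ⟨f, hf, fun h => ?_, (heq f).2 hcard⟩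
    have := minWeight_pos hQ n k
    rw [h, Set.compl_univ, Set.ncard_empty, hq] at hcard
    omega
  · rw [hq, Nat.add_sub_cancel] at hdn
    rw [heq, hq, Nat.add_sub_cancel]
    constructor
    · intro hcard
      -- equality excludes the case of strict inequality, so some hyperplane consists of zeros
      obtain ⟨l, hl, hlf⟩ : ∃ l : Module.Dual F (Fin (n + 1) → F), l ≠ 0 ∧
          ∀ x, l x = 0 → MvPolynomial.eval x f = 0 := by
        by_contra! hcon
        have h := (hcone hf hZ).2 hcon
        rw [weight_eval_eq hf hd, hq, Nat.add_sub_cancel, hcard] at h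
        exact lt_irrefl _ h
      obtain ⟨e, he⟩ := exists_equiv_apply_zero hl
      have hH : Set.range (affineChart e) = {p : PSpace F n | l p.rep = 0}ᶜ := by
        simp only [range_affineChart, he]
      have hHZ : {p : PSpace F n | l p.rep = 0} ⊆ projZeros f := fun p hp => hlf _ hp
      refine ⟨_, ⟨l, hl, rfl⟩, hHZ, e, hH, ?_⟩
      have hdeg := degLE_dehomogenize hf (e := e) (hne hZ) fun v hv => hlf v (by rwa [← he])
      rw [ncard_compl_projZeros hf hH hHZ] at hcard
      have hset : affineChart e ⁻¹' projZeros f = {x | dehomogenize f e x = 0} :=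
        Set.ext fun x => affineChart_mem_projZeros hf e x
      rw [hset, isMaximalAffine_iff, hq, Nat.add_sub_cancel]
      have hk := Nat.div_add_mod' k Q
      have hb := Nat.mod_lt k hQ
      refine ⟨k / Q, k % Q, hk.symm, hb, ?_⟩
      rw [← hk] at hdeg hcard
      refine hasMaximalZeros_of_weight_eq hq hb (Module.finrank_fin_fun F) ?_ hdeg hcard
      exact (Nat.div_lt_iff_lt_mul hQ).2 (by omega)
    · rintro ⟨H, -, hHZ, e, hH, hmax⟩
      have hset : affineChart e ⁻¹' projZeros f = {x | dehomogenize f e x = 0} :=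
        Set.ext fun x => affineChart_mem_projZeros hf e x
      rw [hset, isMaximalAffine_iff, hq, Nat.add_sub_cancel] at hmax
      obtain ⟨a, b, rfl, hb, hmax⟩ := hmax
      rw [ncard_compl_projZeros hf hH hHZ]
      exact weight_eq_of_hasMaximalZeros hq hb (Module.finrank_fin_fun F) hmax
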